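/- Write $\mathbb D(a,r)=\{z\in\mathbb C:|z-a|<r\}$, $\mathbb Z[i]=\mathbb Z+i\mathbb Z$, $I=(1+i)\mathbb Z[i]$ and $J=\frac1{1+i}(\mathbb Z[i]\setminus I)$. For $u,v\in\mathbb C^2$ put $$\mathbb Z[i]u+\mathbb Z[i]v=\{gu+hv:g,h\in\mathbb Z[i]\},\qquad \langle u,v\rangle_J=\{gu+hv:(g,h)\in\mathbb Z[i]^2\cup J^2\},$$ and for $u=(u_1,u_2)$, $v=(v_1,v_2)$ let $\overset{o}{C}(u,v)$ be the interior of the cylinder $$C(u,v)=\{(x,y)\in\mathbb C^2:|x|\le\max(|u_1|,|v_1|),\ |y|\le\max(|u_2|,|v_2|)\}.$$ Let $$\mathcal C=\{z:|z|<1,\ \arg z\in[0,\tfrac\pi4]\},\quad \mathcal D=\{z:|z|<1,\ |z-1|>1,\ |z-(1-i)|>1\},\quad \mathcal T=\{z:|z|<1,\ |z-1|>\sqrt2,\ |z+i|>\sqrt2\}$$ (with $0\in\mathcal C$), and let $$\mathrm{Blue}_1=\mathbb D(\tfrac{1-i}2,\tfrac1{\sqrt2}),\ \mathrm{Blue}_2=\mathbb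 D(1+i,1),\ \mathrm{Red}_1=\mathbb D(i,1),\ \mathrm{Red}_2=\mathbb D(-i,1),\ \mathrm{Green}_1=\mathbb D(1+i,1),\ \mathrm{Green}_2=\mathbb D(\tfrac{1-i}2,\tfrac1{\sqrt2}).$$ **Statement.** Let $u=(u_1,v_2w_2)$ and $v=(u_1w_1,v_2)$ be two vectors in $\mathbb C^2$ with $|u_1|,|v_2|>0$, $|w_1|,|w_2|<1$ and $w_1\in\mathcal C\setminus\{0\}$. * No nonzero vector of $\mathbb Z[i]u+\mathbb Z[i]v$ lies in $\overset{o}{C}(u,v)$ if and only if $w_2\in\overline{\mathcal D}$ and one of the following four conditions holds: 1. $w_2\in\mathrm{Green}_2$ and $w_1\notin\mathrm{Red}_1\cup\mathrm{Green}_1$; 2. $w_2\in\mathrm{Red}_2\setminus\mathrm{Green}_2$ and $w_1\notin\mathrm{Red}_1$; 3. $w_2\notin\mathrm{Red}_2\cup\mathrm{Blue}_2$; 4. $w_2\in\mathrm{Blue}_2$ and $w_1\notin\mathrm{Blue}_1$. * No nonzero vector of $\langle u,v\rangle_J$ lies in $\overset{o}{C}(u,v)$ if and only if $(w_1,w_2)\in(\mathcal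 C\setminus\mathbb D(-i,\sqrt2))\times\overline{\mathcal T}$. -/

import Mathlib

/-- The ring `ℤ[i]` of Gaussian integers, as a subset of `ℂ`. -/
def gaussInts : Set ℂ := Set.range GaussianInt.toComplex

/-- The ideal `I = (1 + i) ℤ[i]`, as a subset of `ℂ`. -/
def idealI : Set ℂ := {z | ∃ x ∈ gaussInts, z = (1 + Complex.I) * x}

/-- The set `J = (1 / (1 + i)) (ℤ[i] \ I)`. -/
def setJ : Set ℂ := {z | ∃ x ∈ gaussInts \ idealI, z = 1 / (1 + Complex.I) * x}

/-- The set `ℤ[i] u + ℤ[i] v`. -/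
def gaussSpan (u v : ℂ × ℂ) : Set (ℂ × ℂ) :=
  {z | ∃ g ∈ gaussInts, ∃ h ∈ gaussInts, z = g • u + h • v}

/-- The set `⟨u, v⟩_J = {g u + h v : (g, h) ∈ ℤ[i]² ∪ J²}`. -/
def spanJ (u v : ℂ × ℂ) : Set (ℂ × ℂ) :=
  {z | ∃ p ∈ gaussInts ×ˢ gaussInts ∪ setJ ×ˢ setJ, z = p.1 • u + p.2 • v}

/-- The cylinder `C(a, b) = {(x, y) : |x| ≤ |a|, |y| ≤ |b|}`. -/
def cylinder (a b : ℝ) : Set (ℂ × ℂ) := {p | ‖p.1‖ ≤ |a| ∧ ‖p.2‖ ≤ |b|}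

/-- The cylinder `C(u, v)` of two vectors. -/
def cylinderOf (u v : ℂ × ℂ) : Set (ℂ × ℂ) :=
  cylinder (max ‖u.1‖ ‖v.1‖) (max ‖u.2‖ ‖v.2‖)

/-- The open cylinder, that is, the interior of `C(u, v)`. -/
def openCylinderOf (u v : ℂ × ℂ) : Set (ℂ × ℂ) := interior (cylinderOf u v)

/-- The sector `𝒞`. -/
def regionC : Set ℂ := {z | ‖z‖ < 1 ∧ Complex.arg z ∈ Set.Icc 0 (Real.pi / 4)}

/-- The region `𝒟`. -/
def regionD : Set ℂ := {z | ‖z‖ < 1 ∧ 1 < dist z 1 ∧ 1 < dist z (1 - Complex.I)}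

/-- The region `𝒯`. -/
def regionT : Set ℂ :=
  {z | ‖z‖ < 1 ∧ Real.sqrt 2 < dist z 1 ∧ Real.sqrt 2 < dist z (-Complex.I)}

def red₁ : Set ℂ := Metric.ball Complex.I 1

def red₂ : Set ℂ := Metric.ball (-Complex.I) 1

def blue₁ : Set ℂ := Metric.ball ((1 - Complex.I) / 2) (1 / Real.sqrt 2)

def blue₂ : Set ℂ := Metric.ball (1 + Complex.I) 1

def green₁ : Set ℂ := Metric.ball (1 + Complex.I) 1

def green₂ : Set ℂ := Metric.ball ((1 - Complex.I) / 2) (1 / Real.sqrt 2)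

/-! Since `g u + h v = (u₁ (g + h w₁), v₂ (g w₂ + h))`, everything reduces to asking which `(g, h)`
satisfy `|g + h w₁| < 1` and `|g w₂ + h| < 1`. Within the given domains five pairs decide: `(1, -1)`
and `(1, -1 + i)` cut out the closure of `𝒟`, while `(1, i)`, `(1 + i, -1)`, `(1, -1 - i)` give the
red, green and blue obstructions. No other pair matters. With `G = |g|²`, `H = |h|²` and `m + n i =
-g h̄`, both squared norms are affine in `m`, `n`, and `m² + n² = G H`. The triangle inequality
forces `|g|` and `|h|` to be close (`norm_gap`), and eliminating `g` bounds `H`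
(`sq_norm_mul_det_lt`). Finitely many `(H, G, m, n)` remain, and each dies by an elementary
inequality (`no_short_vector_real`). For `⟨u, v⟩_J`, multiplying the coefficients by `1 + i` gives
Gaussian integers of equal parity and replaces the bound `1` by `√2`; the pairs `(1, -1)`, `(1, i)`,
`(1, -i)` now decide. -/

/-! ### Finite case analysis on `(H, G, m, n)` -/

/-- Each alternative is one way to exclude a pair. The first constraint says that `w₁` lies in the
disc of centre `(m + n i) / H` and radius `1 / √H`. Alternatives 1, 2 push it off the sector across
the real axis, 6, 7 across the diagonal; 4 contradicts the bounds on `w₂`; 5 is green; the two lists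
hold blue, red and leftovers. -/
theorem int_cases_of_norm_gap {G H m n : ℤ} (hG : 1 ≤ G) (hH : 1 ≤ H) (hH' : H ≤ 7)
    (hmn : m ^ 2 + n ^ 2 = G * H) (hgap : (G + H - 1) ^ 2 < 4 * (G * H)) :
    (n < 0 ∧ m ≤ 0) ∨
    (n < 0 ∧ H ≤ n ^ 2) ∨
    ((H, G, m, n) ∈ [((2 : ℤ), (1 : ℤ), (1 : ℤ), (-1 : ℤ)), (5, 2, 3, -1), (5, 4, 4, -2),
      (2, 5, 3, -1), (5, 8, 6, -2), (5, 10, 7, -1)]) ∨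
    (0 ≤ n ∧ n ≤ m ∧ n < H ∧ m + n < G + H) ∨
    (m = H ∧ n = H ∧ G = 2 * H) ∨
    (m < n ∧ m + n ≤ 0) ∨
    (m < n ∧ 2 * H ≤ (n - m) ^ 2) ∨
    ((H, G, m, n) ∈ [((1 : ℤ), (1 : ℤ), (0 : ℤ), (1 : ℤ)), (4, 5, 2, 4), (5, 2, 1, 3), (5, 4, 2, 4),
      (5, 5, 3, 4), (5, 9, 3, 6)]) := by
  -- The gap says `√G < √H + 1 ≤ √7 + 1`, whose square is below 14.
  have hG' : G ≤ 13 := by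
    by_contra hc
    push Not at hc
    interval_cases H <;> nlinarith
  have key : ∀ H ∈ Finset.Icc (1 : ℤ) 7, ∀ G ∈ Finset.Icc (1 : ℤ) 13,
      (G + H - 1) ^ 2 < 4 * (G * H) → ∀ m ∈ Finset.Icc (-9 : ℤ) 9, ∀ n ∈ Finset.Icc (-9 : ℤ) 9,
      m ^ 2 + n ^ 2 = G * H →
    ((n < 0 ∧ m ≤ 0) ∨
    (n < 0 ∧ H ≤ n ^ 2) ∨
    ((H, G, m, n) ∈ [((2 : ℤ), (1 : ℤ), (1 : ℤ), (-1 : ℤ)), (5, 2, 3, -1), (5, 4, 4, -2),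
      (2, 5, 3, -1), (5, 8, 6, -2), (5, 10, 7, -1)]) ∨
    (0 ≤ n ∧ n ≤ m ∧ n < H ∧ m + n < G + H) ∨
    (m = H ∧ n = H ∧ G = 2 * H) ∨
    (m < n ∧ m + n ≤ 0) ∨
    (m < n ∧ 2 * H ≤ (n - m) ^ 2) ∨
    ((H, G, m, n) ∈ [((1 : ℤ), (1 : ℤ), (0 : ℤ), (1 : ℤ)), (4, 5, 2, 4), (5, 2, 1, 3), (5, 4, 2, 4),
      (5, 5, 3, 4), (5, 9, 3, 6)])) := by
    decide +kernel
  have hGH : G * H ≤ 91 := by nlinarith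
  refine key H (by simp; omega) G (by simp; omega) hgap m ?_ n ?_ hmn <;>
    rw [Finset.mem_Icc] <;> constructor <;> nlinarith

set_option maxHeartbeats 1000000 in
theorem no_short_vector_real {G H m n : ℤ} {x₁ y₁ s₁ x₂ y₂ s₂ : ℝ}
    (hG : 1 ≤ G) (hH : 1 ≤ H) (hH' : H ≤ 7)
    (hmn : m ^ 2 + n ^ 2 = G * H) (hgap : (G + H - 1) ^ 2 < 4 * (G * H))
    (hs₁ : s₁ = x₁ ^ 2 + y₁ ^ 2) (hs₂ : s₂ = x₂ ^ 2 + y₂ ^ 2)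
    (h₁ : s₁ < 1) (hy : 0 ≤ y₁) (hxy : y₁ ≤ x₁) (h₂ : s₂ < 1)
    (hD : 2 * x₂ ≤ s₂) (hD' : 2 * x₂ ≤ s₂ + 2 * y₂ + 1)
    (hR : ¬ (s₁ < 2 * y₁ ∧ s₂ + 2 * y₂ < 0))
    (hGr : ¬ (s₁ + 1 < 2 * x₁ + 2 * y₁ ∧ s₂ < x₂ - y₂))
    (hB : ¬ (s₁ < x₁ - y₁ ∧ s₂ + 1 < 2 * x₂ + 2 * y₂))
    (hA₁ : H * s₁ - 2 * (m * x₁ + n * y₁) + G < 1)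
    (hA₂ : G * s₂ - 2 * (m * x₂ - n * y₂) + H < 1) : False := by
  have hGR : (1 : ℝ) ≤ G := by exact_mod_cast hG
  have hHR : (1 : ℝ) ≤ H := by exact_mod_cast hH
  have hmnR : (m : ℝ) ^ 2 + n ^ 2 = G * H := by exact_mod_cast hmn
  have hs₁0 : 0 ≤ s₁ := by rw [hs₁]; positivity
  have hs₂0 : 0 ≤ s₂ := by rw [hs₂]; positivity
  have hx₁ : x₁ < 1 := by nlinarith
  have hx₁0 : 0 ≤ x₁ := hy.trans hxy
  have hy₂ : -1 < y₂ := by nlinarith [sq_nonneg x₂]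
  have hx₂ : -1 < x₂ := by nlinarith [sq_nonneg y₂]
  rcases int_cases_of_norm_gap hG hH hH' hmn hgap with h | h | h | h | h | h | h | h
  · have hn : (n : ℝ) ≤ 0 := by exact_mod_cast h.1.le
    have hm : (m : ℝ) ≤ 0 := by exact_mod_cast h.2
    linarith [mul_nonneg (neg_nonneg.2 hn) hy, mul_nonneg (neg_nonneg.2 hm) hx₁0,
      mul_nonneg (by linarith : (0 : ℝ) ≤ H) hs₁0]
  · have hn : (n : ℝ) ≤ 0 := by exact_mod_cast h.1.le
    have hHn : (H : ℝ) ≤ n ^ 2 := by exact_mod_cast h.2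
    have h3 : H * x₁ ^ 2 - 2 * m * x₁ + G < 1 := by
      nlinarith [mul_nonneg (neg_nonneg.2 hn) hy, mul_nonneg (by linarith : (0 : ℝ) ≤ H) (sq_nonneg y₁)]
    -- Completing the square: `H` times `h3` reads `(H x₁ - m)² + n² < H`, because `G H - m² = n²`.
    nlinarith [sq_nonneg (H * x₁ - m), mul_lt_mul_of_pos_left h3 (by linarith : (0 : ℝ) < H)]
  · simp only [List.mem_cons, Prod.mk.injEq, List.not_mem_nil, or_false] at h
    rcases h with ⟨rfl, rfl, rfl, rfl⟩ | ⟨rfl, rfl, rfl, rfl⟩ | ⟨rfl, rfl, rfl, rfl⟩ |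
      ⟨rfl, rfl, rfl, rfl⟩ | ⟨rfl, rfl, rfl, rfl⟩ | ⟨rfl, rfl, rfl, rfl⟩ <;>
      push_cast at hA₁ hA₂
    · exact hB ⟨by linarith, by linarith⟩
    all_goals nlinarith only [hA₁, hA₂, hs₁, hs₂, h₁, hy, hxy, h₂, hD, hD', hx₁, hy₂, hx₂,
      sq_nonneg (x₁ - 1), sq_nonneg y₁, sq_nonneg x₂, sq_nonneg y₂]
  · obtain ⟨hn, hnm, hnH, hsum⟩ := h
    have e1 : (0 : ℝ) ≤ n := by exact_mod_cast hn
    have e2 : (n : ℝ) ≤ m := by exact_mod_cast hnm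
    have e3 : (n : ℝ) + 1 ≤ H := by exact_mod_cast hnH
    have e4 : (m : ℝ) + n + 1 ≤ G + H := by exact_mod_cast hsum
    -- Weighting `hD'` by `n` and `hD` by `m - n` bounds the left side of `hA₂` below by `(G - m) s₂
    -- + H - n`. This is affine in `s₂` and at least 1 at both `s₂ = 0` and `s₂ = 1`.
    nlinarith [mul_nonneg e1 (sub_nonneg.2 hD'), mul_nonneg (sub_nonneg.2 e2) (sub_nonneg.2 hD),
      mul_nonneg (sub_nonneg.2 e3) (sub_nonneg.2 h₂.le), mul_nonneg (sub_nonneg.2 e4) hs₂0]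
  · obtain ⟨h1, h2, h3⟩ := h
    rw [h1, h2, h3] at hA₁ hA₂
    push_cast at hA₁ hA₂
    refine hGr ⟨?_, ?_⟩
    · by_contra hc
      have := mul_nonneg (by linarith : (0 : ℝ) ≤ H) (sub_nonneg.2 (not_lt.1 hc))
      linarith
    · by_contra hc
      have := mul_nonneg (by linarith : (0 : ℝ) ≤ H) (sub_nonneg.2 (not_lt.1 hc))
      linarith
  · have hm : (m : ℝ) + 1 ≤ n := by exact_mod_cast h.1
    have hmn0 : (m : ℝ) + n ≤ 0 := by exact_mod_cast h.2
    have : m * x₁ + n * y₁ ≤ 0 := by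
      linarith [mul_nonneg (neg_nonneg.2 hmn0) hx₁0,
        mul_nonneg (by linarith : (0 : ℝ) ≤ n - m) (sub_nonneg.2 hxy),
        mul_nonneg (neg_nonneg.2 hmn0) hy]
    linarith [mul_nonneg (by linarith : (0 : ℝ) ≤ H) hs₁0]
  · have hm : (m : ℝ) + 1 ≤ n := by exact_mod_cast h.1
    have hHn : 2 * (H : ℝ) ≤ (n - m) ^ 2 := by exact_mod_cast h.2
    have h3 : H * (x₁ + y₁) ^ 2 - 2 * (m + n) * (x₁ + y₁) + 2 * G < 2 := by
      nlinarith [mul_nonneg (by linarith : (0 : ℝ) ≤ n - m) (sub_nonneg.2 hxy),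
        mul_nonneg (by linarith : (0 : ℝ) ≤ H) (sq_nonneg (x₁ - y₁))]
    nlinarith [sq_nonneg (H * (x₁ + y₁) - (m + n)),
      mul_lt_mul_of_pos_left h3 (by linarith : (0 : ℝ) < H)]
  · simp only [List.mem_cons, Prod.mk.injEq, List.not_mem_nil, or_false] at h
    rcases h with ⟨rfl, rfl, rfl, rfl⟩ | ⟨rfl, rfl, rfl, rfl⟩ | ⟨rfl, rfl, rfl, rfl⟩ |
      ⟨rfl, rfl, rfl, rfl⟩ | ⟨rfl, rfl, rfl, rfl⟩ | ⟨rfl, rfl, rfl, rfl⟩ <;>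
      push_cast at hA₁ hA₂
    · exact hR ⟨by linarith, by linarith⟩
    -- For `(4, 5, 2, 4)` the two constraints, with `x₁ < 1` and `hD`, already force the red
    -- obstruction.
    · exact hR ⟨by linarith, by linarith⟩
    · nlinarith only [hA₂, hs₂, hD', hy₂, sq_nonneg (y₂ + 1), sq_nonneg x₂]
    · nlinarith only [hA₂, hs₂, hD', hy₂, sq_nonneg (y₂ + 1), sq_nonneg x₂]
    · nlinarith only [hA₂, hs₂, hD', hy₂, sq_nonneg (2 * y₂ + 1), sq_nonneg x₂]
    -- `7 / 10` approximates `1 / √2`, the coordinates of the sector's corner on the diagonal.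
    · nlinarith [sq_nonneg (x₁ - 7 / 10), sq_nonneg (y₁ - 7 / 10)]

-- When `m`, `n` are both nonnegative the constraint on `w₂` fails, when both are nonpositive the
-- one on `w₁`; only mixed signs need listing.
set_option synthInstance.maxSize 2000 in
set_option synthInstance.maxHeartbeats 200000 in
theorem int_cases_of_norm_gap_even {G H m n : ℤ} (hG : 1 ≤ G) (hH : 1 ≤ H) (hG' : G ≤ 6)
    (hH' : H ≤ 6) (hpar : Even (G + H))
    (hmn : m ^ 2 + n ^ 2 = G * H) (hgap : (G + H - 2) ^ 2 < 4 * (G * H)) :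
    (0 ≤ m ∧ 0 ≤ n ∧ 1 ≤ m + n) ∨ (m ≤ 0 ∧ n ≤ 0 ∧ m + n ≤ -1) ∨
    ((H, G, m, n) ∈ [((1 : ℤ), (5 : ℤ), (1 : ℤ), (-2 : ℤ)), (1, 5, 2, -1), (1, 5, -1, 2),
      (1, 5, -2, 1), (5, 1, 1, -2), (5, 1, 2, -1), (5, 1, -1, 2), (5, 1, -2, 1), (2, 4, 2, -2),
      (2, 4, -2, 2), (4, 2, 2, -2), (4, 2, -2, 2), (5, 5, 3, -4), (5, 5, 4, -3), (5, 5, -3, 4),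
      (5, 5, -4, 3)]) := by
  have key : ∀ H ∈ Finset.Icc (1 : ℤ) 6, ∀ G ∈ Finset.Icc (1 : ℤ) 6, (G + H) % 2 = 0 →
      (G + H - 2) ^ 2 < 4 * (G * H) → ∀ m ∈ Finset.Icc (-6 : ℤ) 6, ∀ n ∈ Finset.Icc (-6 : ℤ) 6,
      m ^ 2 + n ^ 2 = G * H →
      ((0 ≤ m ∧ 0 ≤ n ∧ 1 ≤ m + n) ∨ (m ≤ 0 ∧ n ≤ 0 ∧ m + n ≤ -1) ∨
    ((H, G, m, n) ∈ [((1 : ℤ), (5 : ℤ), (1 : ℤ), (-2 : ℤ)), (1, 5, 2, -1), (1, 5, -1, 2),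
      (1, 5, -2, 1), (5, 1, 1, -2), (5, 1, 2, -1), (5, 1, -1, 2), (5, 1, -2, 1), (2, 4, 2, -2),
      (2, 4, -2, 2), (4, 2, 2, -2), (4, 2, -2, 2), (5, 5, 3, -4), (5, 5, 4, -3), (5, 5, -3, 4),
      (5, 5, -4, 3)])) := by
    decide +kernel
  have hGH : G * H ≤ 36 := by nlinarith
  refine key H (by simp; omega) G (by simp; omega) (Int.even_iff.1 hpar) hgap m ?_ n ?_ hmn <;>
    rw [Finset.mem_Icc] <;> constructor <;> nlinarith

theorem no_short_vector_real_even {G H m n : ℤ} {x₁ y₁ s₁ x₂ y₂ s₂ : ℝ}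
    (hG : 1 ≤ G) (hH : 1 ≤ H) (hG' : G ≤ 6) (hH' : H ≤ 6) (hpar : Even (G + H))
    (hmn : m ^ 2 + n ^ 2 = G * H) (hgap : (G + H - 2) ^ 2 < 4 * (G * H))
    (hs₁ : s₁ = x₁ ^ 2 + y₁ ^ 2) (hs₂ : s₂ = x₂ ^ 2 + y₂ ^ 2)
    (h₁ : s₁ < 1) (hxy : y₁ ≤ x₁) (hC : 1 ≤ s₁ + 2 * y₁) (h₂ : s₂ < 1)
    (hT : 2 * x₂ ≤ s₂ - 1) (hT' : 1 - s₂ ≤ 2 * y₂)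
    (hA₁ : H * s₁ - 2 * (m * x₁ + n * y₁) + G < 2)
    (hA₂ : G * s₂ - 2 * (m * x₂ - n * y₂) + H < 2) : False := by
  have hGR : (1 : ℝ) ≤ G := by exact_mod_cast hG
  have hHR : (1 : ℝ) ≤ H := by exact_mod_cast hH
  have hs₁0 : 0 ≤ s₁ := by rw [hs₁]; positivity
  have hs₂0 : 0 ≤ s₂ := by rw [hs₂]; positivity
  have hy₁0 : 0 ≤ y₁ := by linarith
  have hx₁ : x₁ < 1 := by nlinarith
  have hx₂ : -1 < x₂ := by nlinarith [sq_nonneg y₂]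
  have hy₂ : y₂ < 1 := by nlinarith [sq_nonneg x₂]
  rcases int_cases_of_norm_gap_even hG hH hG' hH' hpar hmn hgap with ⟨h1, h2, h3⟩ | ⟨h1, h2, h3⟩ | h
  · have hm : (0 : ℝ) ≤ m := by exact_mod_cast h1
    have hn : (0 : ℝ) ≤ n := by exact_mod_cast h2
    have hs : (1 : ℝ) ≤ m + n := by exact_mod_cast h3
    nlinarith [mul_nonneg hm (sub_nonneg.2 hT), mul_nonneg hn (sub_nonneg.2 hT'),
      mul_nonneg (sub_nonneg.2 hs) (sub_nonneg.2 h₂.le), mul_nonneg (sub_nonneg.2 hGR) hs₂0]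
  · have hm : (m : ℝ) ≤ 0 := by exact_mod_cast h1
    have hn : (n : ℝ) ≤ 0 := by exact_mod_cast h2
    have hs : (m : ℝ) + n ≤ -1 := by exact_mod_cast h3
    nlinarith [mul_nonneg (neg_nonneg.2 hm) (by linarith : 0 ≤ s₁ + 2 * x₁ - 1),
      mul_nonneg (neg_nonneg.2 hn) (sub_nonneg.2 hC),
      mul_nonneg (sub_nonneg.2 hs) (sub_nonneg.2 h₁.le), mul_nonneg (sub_nonneg.2 hHR) hs₁0]
  · simp only [List.mem_cons, Prod.mk.injEq, List.not_mem_nil, or_false] at h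
    rcases h with ⟨rfl, rfl, rfl, rfl⟩ | ⟨rfl, rfl, rfl, rfl⟩ | ⟨rfl, rfl, rfl, rfl⟩ |
      ⟨rfl, rfl, rfl, rfl⟩ | ⟨rfl, rfl, rfl, rfl⟩ | ⟨rfl, rfl, rfl, rfl⟩ | ⟨rfl, rfl, rfl, rfl⟩ |
      ⟨rfl, rfl, rfl, rfl⟩ | ⟨rfl, rfl, rfl, rfl⟩ | ⟨rfl, rfl, rfl, rfl⟩ | ⟨rfl, rfl, rfl, rfl⟩ |
      ⟨rfl, rfl, rfl, rfl⟩ | ⟨rfl, rfl, rfl, rfl⟩ | ⟨rfl, rfl, rfl, rfl⟩ | ⟨rfl, rfl, rfl, rfl⟩ |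
      ⟨rfl, rfl, rfl, rfl⟩ <;>
      push_cast at hA₁ hA₂ <;>
      nlinarith only [hA₁, hA₂, hs₁, hs₂, h₁, hxy, hC, h₂, hT, hT', hx₁, hy₂, hx₂, hy₁0,
        sq_nonneg (x₁ - 1), sq_nonneg y₁, sq_nonneg (x₂ + 1), sq_nonneg y₂]

/-! ### Discs and regions as polynomial inequalities -/

theorem mem_ball_iff_sq {z c : ℂ} {r : ℝ} (hr : 0 < r) :
    z ∈ Metric.ball c r ↔ (z.re - c.re) ^ 2 + (z.im - c.im) ^ 2 < r ^ 2 := by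
  rw [Metric.mem_ball, Complex.dist_eq_re_im, Real.sqrt_lt' hr]

theorem norm_lt_iff_sq {z : ℂ} {r : ℝ} (hr : 0 < r) :
    ‖z‖ < r ↔ z.re ^ 2 + z.im ^ 2 < r ^ 2 := by
  rw [Complex.norm_def, Real.sqrt_lt' hr, Complex.normSq_apply]
  simp only [sq]

theorem lt_dist_iff_sq {z c : ℂ} {r : ℝ} (hr : 0 ≤ r) :
    r < dist z c ↔ r ^ 2 < (z.re - c.re) ^ 2 + (z.im - c.im) ^ 2 := by
  rw [Complex.dist_eq_re_im, Real.lt_sqrt hr]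

theorem mem_regionD_iff {z : ℂ} : z ∈ regionD ↔
    z.re ^ 2 + z.im ^ 2 < 1 ∧ 2 * z.re < z.re ^ 2 + z.im ^ 2 ∧
      2 * z.re < z.re ^ 2 + z.im ^ 2 + 2 * z.im + 1 := by
  rw [regionD, Set.mem_ofPred_eq, norm_lt_iff_sq one_pos, lt_dist_iff_sq zero_le_one,
    lt_dist_iff_sq zero_le_one]
  simp only [Complex.one_re, Complex.one_im, Complex.sub_re, Complex.sub_im, Complex.I_re,
    Complex.I_im]
  refine and_congr (by norm_num) (and_congr ?_ ?_) <;> constructor <;> intro h <;> nlinarith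

theorem mem_regionT_iff {z : ℂ} : z ∈ regionT ↔
    z.re ^ 2 + z.im ^ 2 < 1 ∧ 2 * z.re < z.re ^ 2 + z.im ^ 2 - 1 ∧
      1 - (z.re ^ 2 + z.im ^ 2) < 2 * z.im := by
  rw [regionT, Set.mem_ofPred_eq, norm_lt_iff_sq one_pos, lt_dist_iff_sq (Real.sqrt_nonneg _),
    lt_dist_iff_sq (Real.sqrt_nonneg _), Real.sq_sqrt (by norm_num)]
  simp only [Complex.one_re, Complex.one_im, Complex.neg_re, Complex.neg_im, Complex.I_re,
    Complex.I_im]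
  refine and_congr (by norm_num) (and_congr ?_ ?_) <;> constructor <;> intro h <;> nlinarith

theorem mem_closure_regionD_iff {z : ℂ} (hz : z.re ^ 2 + z.im ^ 2 < 1) :
    z ∈ closure regionD ↔
      2 * z.re ≤ z.re ^ 2 + z.im ^ 2 ∧ 2 * z.re ≤ z.re ^ 2 + z.im ^ 2 + 2 * z.im + 1 := by
  constructor
  · intro h
    have hcl : IsClosed ({w : ℂ | 2 * w.re ≤ w.re ^ 2 + w.im ^ 2} ∩
        {w : ℂ | 2 * w.re ≤ w.re ^ 2 + w.im ^ 2 + 2 * w.im + 1}) :=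
      (isClosed_le (by fun_prop) (by fun_prop)).inter (isClosed_le (by fun_prop) (by fun_prop))
    refine closure_minimal ?_ hcl h
    intro w hw
    exact ⟨(mem_regionD_iff.1 hw).2.1.le, (mem_regionD_iff.1 hw).2.2.le⟩
  · rintro ⟨h1, h2⟩
    have hre : z.re < 1 := by nlinarith
    -- A shift to the left moves away from both centres `1` and `1 - i`, since `z.re < 1`, so it
    -- makes the inequalities strict.
    have hlim : Filter.Tendsto (fun t : ℝ => z - (t : ℂ)) (nhdsWithin 0 (Set.Ioi 0)) (nhds z) := by
      have : Continuous fun t : ℝ => z - (t : ℂ) := by fun_prop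
      simpa using (this.tendsto 0).mono_left nhdsWithin_le_nhds
    have hcont : Continuous fun w : ℂ => w.re ^ 2 + w.im ^ 2 := by fun_prop
    refine mem_closure_of_tendsto hlim ?_
    filter_upwards [hlim.eventually ((isOpen_lt hcont continuous_const).mem_nhds hz),
      self_mem_nhdsWithin] with t ht ht0
    have ht0 : 0 < t := ht0
    refine mem_regionD_iff.2 ⟨ht, ?_, ?_⟩ <;> simp <;> nlinarith

theorem mem_closure_regionT_iff {z : ℂ} (hz : z.re ^ 2 + z.im ^ 2 < 1) :
    z ∈ closure regionT ↔
      2 * z.re ≤ z.re ^ 2 + z.im ^ 2 - 1 ∧ 1 - (z.re ^ 2 + z.im ^ 2) ≤ 2 * z.im := by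
  constructor
  · intro h
    have hcl : IsClosed ({w : ℂ | 2 * w.re ≤ w.re ^ 2 + w.im ^ 2 - 1} ∩
        {w : ℂ | 1 - (w.re ^ 2 + w.im ^ 2) ≤ 2 * w.im}) :=
      (isClosed_le (by fun_prop) (by fun_prop)).inter (isClosed_le (by fun_prop) (by fun_prop))
    refine closure_minimal ?_ hcl h
    intro w hw
    exact ⟨(mem_regionT_iff.1 hw).2.1.le, (mem_regionT_iff.1 hw).2.2.le⟩
  · rintro ⟨h1, h2⟩
    have hlim : Filter.Tendsto (fun t : ℝ => z + (t : ℂ) * (-1 + Complex.I))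
        (nhdsWithin 0 (Set.Ioi 0)) (nhds z) := by
      have : Continuous fun t : ℝ => z + (t : ℂ) * (-1 + Complex.I) := by fun_prop
      simpa using (this.tendsto 0).mono_left nhdsWithin_le_nhds
    have hcont : Continuous fun w : ℂ => w.re ^ 2 + w.im ^ 2 := by fun_prop
    refine mem_closure_of_tendsto hlim ?_
    filter_upwards [hlim.eventually ((isOpen_lt hcont continuous_const).mem_nhds hz),
      self_mem_nhdsWithin] with t ht ht0
    have ht0 : 0 < t := ht0
    refine mem_regionT_iff.2 ⟨ht, ?_, ?_⟩ <;> simp <;> nlinarith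

theorem regionC_bounds {z : ℂ} (hz : z ∈ regionC) :
    z.re ^ 2 + z.im ^ 2 < 1 ∧ 0 ≤ z.im ∧ z.im ≤ z.re := by
  obtain ⟨h1, h2, h3⟩ := hz
  have hpi := Real.pi_pos
  refine ⟨by simpa using (norm_lt_iff_sq one_pos).1 h1, Complex.arg_nonneg_iff.1 h2, ?_⟩
  rw [← Complex.norm_mul_cos_arg z, ← Complex.norm_mul_sin_arg z]
  refine mul_le_mul_of_nonneg_left ?_ (norm_nonneg z)
  calc Real.sin z.arg ≤ Real.sin (Real.pi / 4) :=
        Real.sin_le_sin_of_le_of_le_pi_div_two (by linarith) (by linarith) h3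
    _ = Real.cos (Real.pi / 4) := by rw [Real.sin_pi_div_four, Real.cos_pi_div_four]
    _ ≤ Real.cos z.arg := Real.cos_le_cos_of_nonneg_of_le_pi h2 (by linarith) h3

/-! ### From the cylinder and the spans to coefficient pairs -/

theorem mem_openCylinderOf_iff {u₁ v₂ w₁ w₂ : ℂ} (hu₁ : 0 < ‖u₁‖) (hv₂ : 0 < ‖v₂‖)
    (hw₁ : ‖w₁‖ < 1) (hw₂ : ‖w₂‖ < 1) (g h : ℂ) :
    g • (u₁, v₂ * w₂) + h • (u₁ * w₁, v₂) ∈ openCylinderOf (u₁, v₂ * w₂) (u₁ * w₁, v₂) ↔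
      ‖g + h * w₁‖ < 1 ∧ ‖g * w₂ + h‖ < 1 := by
  have hm₁ : max ‖u₁‖ ‖u₁ * w₁‖ = ‖u₁‖ := by
    rw [norm_mul]; exact max_eq_left (by nlinarith)
  have hm₂ : max ‖v₂ * w₂‖ ‖v₂‖ = ‖v₂‖ := by
    rw [norm_mul]; exact max_eq_right (by nlinarith)
  have hcyl : cylinder ‖u₁‖ ‖v₂‖ = Metric.closedBall (0 : ℂ) ‖u₁‖ ×ˢ Metric.closedBall (0 : ℂ) ‖v₂‖ := by
    ext p
    simp [cylinder]
  rw [openCylinderOf, cylinderOf, hm₁, hm₂, hcyl, interior_prod_eq,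
    interior_closedBall _ hu₁.ne', interior_closedBall _ hv₂.ne', Set.mem_prod]
  have e₁ : g * u₁ + h * (u₁ * w₁) = u₁ * (g + h * w₁) := by ring
  have e₂ : g * (v₂ * w₂) + h * v₂ = v₂ * (g * w₂ + h) := by ring
  simp only [Prod.fst_add, Prod.snd_add, Prod.smul_fst, Prod.smul_snd, smul_eq_mul,
    mem_ball_zero_iff, e₁, e₂, norm_mul, mul_lt_iff_lt_one_right hu₁, mul_lt_iff_lt_one_right hv₂]

theorem smul_add_smul_eq_zero_iff {u₁ v₂ w₁ w₂ : ℂ} (hu₁ : 0 < ‖u₁‖) (hv₂ : 0 < ‖v₂‖)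
    (hw₁ : ‖w₁‖ < 1) (hw₂ : ‖w₂‖ < 1) (g h : ℂ) :
    g • (u₁, v₂ * w₂) + h • (u₁ * w₁, v₂) = 0 ↔ g = 0 ∧ h = 0 := by
  constructor
  · intro hz
    have h1 := congrArg Prod.fst hz
    have h2 := congrArg Prod.snd hz
    simp only [Prod.fst_add, Prod.snd_add, Prod.smul_fst, Prod.smul_snd, smul_eq_mul,
      Prod.fst_zero, Prod.snd_zero] at h1 h2
    have e₁ : g + h * w₁ = 0 := by
      refine (mul_eq_zero.1 (?_ : u₁ * (g + h * w₁) = 0)).resolve_left (norm_pos_iff.1 hu₁)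
      rw [← h1]; ring
    have e₂ : g * w₂ + h = 0 := by
      refine (mul_eq_zero.1 (?_ : v₂ * (g * w₂ + h) = 0)).resolve_left (norm_pos_iff.1 hv₂)
      rw [← h2]; ring
    -- `1 - w₁ w₂` is the determinant of the system, nonzero because `|w₁ w₂| < 1`.
    have e₃ : g * (1 - w₂ * w₁) = 0 := by linear_combination e₁ - w₁ * e₂
    have hg : g = 0 := by
      refine (mul_eq_zero.1 e₃).resolve_right fun hc => ?_
      have : ‖w₂ * w₁‖ = 1 := by rw [← sub_eq_zero.1 hc, norm_one]
      rw [norm_mul] at this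
      nlinarith [norm_nonneg w₁, norm_nonneg w₂]
    exact ⟨hg, by simpa [hg] using e₂⟩
  · rintro ⟨rfl, rfl⟩
    simp

theorem no_vector_in_openCylinderOf_iff {u₁ v₂ w₁ w₂ : ℂ} (hu₁ : 0 < ‖u₁‖) (hv₂ : 0 < ‖v₂‖)
    (hw₁ : ‖w₁‖ < 1) (hw₂ : ‖w₂‖ < 1) (S : Set (ℂ × ℂ)) :
    (¬ ∃ x, (∃ p ∈ S, x = p.1 • (u₁, v₂ * w₂) + p.2 • (u₁ * w₁, v₂)) ∧
      x ≠ 0 ∧ x ∈ openCylinderOf (u₁, v₂ * w₂) (u₁ * w₁, v₂)) ↔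
    ∀ g h : ℂ, (g, h) ∈ S → ‖g + h * w₁‖ < 1 → ‖g * w₂ + h‖ < 1 → g = 0 ∧ h = 0 := by
  constructor
  · intro hS g h hgh h1 h2
    by_contra hne
    exact hS ⟨_, ⟨(g, h), hgh, rfl⟩, fun h0 => hne
      ((smul_add_smul_eq_zero_iff hu₁ hv₂ hw₁ hw₂ g h).1 h0),
      (mem_openCylinderOf_iff hu₁ hv₂ hw₁ hw₂ g h).2 ⟨h1, h2⟩⟩
  · rintro hS ⟨x, ⟨⟨g, h⟩, hgh, rfl⟩, hne, hx⟩
    have hx' := (mem_openCylinderOf_iff hu₁ hv₂ hw₁ hw₂ g h).1 hx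
    exact hne ((smul_add_smul_eq_zero_iff hu₁ hv₂ hw₁ hw₂ g h).2 (hS g h hgh hx'.1 hx'.2))

theorem toComplex_mem_idealI_iff (x : GaussianInt) :
    GaussianInt.toComplex x ∈ idealI ↔ Even (x.re + x.im) := by
  constructor
  · rintro ⟨_, ⟨y, rfl⟩, hy⟩
    have h : x = ⟨1, 1⟩ * y := by
      apply GaussianInt.toComplex_injective
      rw [hy, map_mul]
      simp [GaussianInt.toComplex_def]
    refine ⟨y.re, ?_⟩
    rw [h]
    simp
  · rintro ⟨k, hk⟩
    refine ⟨_, ⟨⟨k, k - x.re⟩, rfl⟩, ?_⟩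
    have h : x = ⟨1, 1⟩ * ⟨k, k - x.re⟩ := by
      ext <;> simp <;> linarith
    conv_lhs => rw [h]
    rw [map_mul]
    simp [GaussianInt.toComplex_def]

theorem mem_setJ_iff {z : ℂ} :
    z ∈ setJ ↔ ∃ x : GaussianInt, Odd (x.re + x.im) ∧ (1 + Complex.I) * z = GaussianInt.toComplex x := by
  have hne : (1 + Complex.I) ≠ 0 := by
    intro h
    simpa using congrArg Complex.re h
  constructor
  · rintro ⟨_, ⟨⟨x, rfl⟩, hx⟩, rfl⟩
    refine ⟨x, ?_, by field_simp⟩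
    rwa [toComplex_mem_idealI_iff, Int.not_even_iff_odd] at hx
  · rintro ⟨x, hx, hz⟩
    refine ⟨_, ⟨⟨x, rfl⟩, ?_⟩, ?_⟩
    · rwa [toComplex_mem_idealI_iff, Int.not_even_iff_odd]
    · rw [← hz]; field_simp

/-! ### Bounds on the coefficients -/

theorem norm_gap {g h w₁ w₂ : ℂ} {r : ℝ} (hw₁ : ‖w₁‖ ≤ 1) (hw₂ : ‖w₂‖ ≤ 1)
    (hA₁ : ‖g + h * w₁‖ < r) (hA₂ : ‖g * w₂ + h‖ < r) :
    ‖g‖ ^ 2 + ‖h‖ ^ 2 - r ^ 2 < 2 * (‖g‖ * ‖h‖) := by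
  have h1 : ‖g‖ < r + ‖h‖ := by
    have : ‖g‖ ≤ ‖g + h * w₁‖ + ‖h * w₁‖ := by
      simpa using norm_sub_le (g + h * w₁) (h * w₁)
    rw [norm_mul] at this
    nlinarith [norm_nonneg h]
  have h2 : ‖h‖ < r + ‖g‖ := by
    have : ‖h‖ ≤ ‖g * w₂ + h‖ + ‖g * w₂‖ := by
      simpa using norm_sub_le (g * w₂ + h) (g * w₂)
    rw [norm_mul] at this
    nlinarith [norm_nonneg g]
  nlinarith [sq_abs (‖g‖ - ‖h‖), abs_lt.2 ⟨by linarith, by linarith⟩ |> fun h : |‖g‖ - ‖h‖| < r => h]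

theorem norm_add_mul_lt_iff (g h : GaussianInt) (w : ℂ) {r : ℝ} (hr : 0 < r) :
    ‖(g : ℂ) + h * w‖ < r ↔
      ((h.re ^ 2 + h.im ^ 2 : ℤ) : ℝ) * (w.re ^ 2 + w.im ^ 2) -
        2 * (((-(g.re * h.re + g.im * h.im) : ℤ) : ℝ) * w.re +
          ((g.re * h.im - g.im * h.re : ℤ) : ℝ) * w.im) +
        ((g.re ^ 2 + g.im ^ 2 : ℤ) : ℝ) < r ^ 2 := by
  rw [norm_lt_iff_sq hr]
  simp only [Complex.add_re, Complex.add_im, Complex.mul_re, Complex.mul_im,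
    ← GaussianInt.intCast_re, ← GaussianInt.intCast_im]
  push_cast
  constructor <;> intro H <;> linarith

theorem norm_mul_add_lt_iff (g h : GaussianInt) (w : ℂ) {r : ℝ} (hr : 0 < r) :
    ‖(g : ℂ) * w + h‖ < r ↔
      ((g.re ^ 2 + g.im ^ 2 : ℤ) : ℝ) * (w.re ^ 2 + w.im ^ 2) -
        2 * (((-(g.re * h.re + g.im * h.im) : ℤ) : ℝ) * w.re -
          ((g.re * h.im - g.im * h.re : ℤ) : ℝ) * w.im) +
        ((h.re ^ 2 + h.im ^ 2 : ℤ) : ℝ) < r ^ 2 := by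
  rw [add_comm, norm_add_mul_lt_iff h g w hr]
  push_cast
  constructor <;> intro H <;> linarith

theorem sq_norm_eq (z : ℂ) : ‖z‖ ^ 2 = z.re ^ 2 + z.im ^ 2 := by
  rw [Complex.sq_norm, Complex.normSq_apply]; ring

theorem gaussianInt_sq_norm_eq (g : GaussianInt) :
    ‖(g : ℂ)‖ ^ 2 = ((g.re ^ 2 + g.im ^ 2 : ℤ) : ℝ) := by
  rw [sq_norm_eq]; simp

/-- Cramer's rule eliminates `g`; then `(1 + a)² ≤ 2 (1 + a²)` with `a = |w₂|`. -/
theorem sq_norm_mul_det_lt {g h w₁ w₂ : ℂ} {r : ℝ}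
    (hA₁ : ‖g + h * w₁‖ < r) (hA₂ : ‖g * w₂ + h‖ < r) :
    ‖h‖ ^ 2 * ‖1 - w₁ * w₂‖ ^ 2 < 2 * r ^ 2 * (1 + ‖w₂‖ ^ 2) := by
  have e : h * (1 - w₁ * w₂) = (g * w₂ + h) - w₂ * (g + h * w₁) := by ring
  have h1 : ‖h‖ * ‖1 - w₁ * w₂‖ ≤ ‖g * w₂ + h‖ + ‖w₂‖ * ‖g + h * w₁‖ := by
    rw [← norm_mul, ← norm_mul, e]
    exact norm_sub_le _ _
  have h2 : ‖h‖ * ‖1 - w₁ * w₂‖ < r * (1 + ‖w₂‖) := by nlinarith [norm_nonneg w₂]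
  have h3 : (‖h‖ * ‖1 - w₁ * w₂‖) ^ 2 < (r * (1 + ‖w₂‖)) ^ 2 :=
    pow_lt_pow_left₀ h2 (by positivity) two_ne_zero
  nlinarith [mul_nonneg (sq_nonneg r) (sq_nonneg (1 - ‖w₂‖))]

theorem int_gap {g h : GaussianInt} {w₁ w₂ : ℂ} {r : ℝ} {k : ℤ} (hk : r ^ 2 = k)
    (hw₁ : ‖w₁‖ ≤ 1) (hw₂ : ‖w₂‖ ≤ 1)
    (hA₁ : ‖(g : ℂ) + h * w₁‖ < r) (hA₂ : ‖(g : ℂ) * w₂ + h‖ < r)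
    (h0 : k ≤ g.re ^ 2 + g.im ^ 2 + (h.re ^ 2 + h.im ^ 2)) :
    (g.re ^ 2 + g.im ^ 2 + (h.re ^ 2 + h.im ^ 2) - k) ^ 2 <
      4 * ((g.re ^ 2 + g.im ^ 2) * (h.re ^ 2 + h.im ^ 2)) := by
  have hgap := norm_gap hw₁ hw₂ hA₁ hA₂
  rw [gaussianInt_sq_norm_eq, gaussianInt_sq_norm_eq, hk] at hgap
  have h0' : (k : ℝ) ≤ ((g.re ^ 2 + g.im ^ 2 : ℤ) : ℝ) + ((h.re ^ 2 + h.im ^ 2 : ℤ) : ℝ) := by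
    exact_mod_cast h0
  have h1 := pow_lt_pow_left₀ hgap (by linarith) two_ne_zero
  have e : (2 * (‖(g : ℂ)‖ * ‖(h : ℂ)‖)) ^ 2 =
      4 * (((g.re ^ 2 + g.im ^ 2 : ℤ) : ℝ) * ((h.re ^ 2 + h.im ^ 2 : ℤ) : ℝ)) := by
    rw [← gaussianInt_sq_norm_eq, ← gaussianInt_sq_norm_eq]; ring
  rw [e] at h1
  exact_mod_cast h1

theorem gaussianInt_eq_zero_of_sq_le {g : GaussianInt} (h : g.re ^ 2 + g.im ^ 2 ≤ 0) : g = 0 := by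
  have h1 : g.re = 0 := by nlinarith [sq_nonneg g.re, sq_nonneg g.im]
  have h2 : g.im = 0 := by nlinarith [sq_nonneg g.re, sq_nonneg g.im]
  ext <;> simp [h1, h2]

theorem no_short_vector {w₁ w₂ : ℂ} (g h : GaussianInt)
    (h₁ : w₁.re ^ 2 + w₁.im ^ 2 < 1) (hy : 0 ≤ w₁.im) (hxy : w₁.im ≤ w₁.re)
    (h₂ : w₂.re ^ 2 + w₂.im ^ 2 < 1)
    (hD : 2 * w₂.re ≤ w₂.re ^ 2 + w₂.im ^ 2)
    (hD' : 2 * w₂.re ≤ w₂.re ^ 2 + w₂.im ^ 2 + 2 * w₂.im + 1)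
    (hR : ¬ (w₁.re ^ 2 + w₁.im ^ 2 < 2 * w₁.im ∧ w₂.re ^ 2 + w₂.im ^ 2 + 2 * w₂.im < 0))
    (hG : ¬ (w₁.re ^ 2 + w₁.im ^ 2 + 1 < 2 * w₁.re + 2 * w₁.im ∧
      w₂.re ^ 2 + w₂.im ^ 2 < w₂.re - w₂.im))
    (hB : ¬ (w₁.re ^ 2 + w₁.im ^ 2 < w₁.re - w₁.im ∧
      w₂.re ^ 2 + w₂.im ^ 2 + 1 < 2 * w₂.re + 2 * w₂.im))
    (hA₁ : ‖(g : ℂ) + h * w₁‖ < 1) (hA₂ : ‖(g : ℂ) * w₂ + h‖ < 1) : g = 0 ∧ h = 0 := by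
  have hw₁ : ‖w₁‖ < 1 := (norm_lt_iff_sq one_pos).2 (by linarith)
  have hw₂ : ‖w₂‖ < 1 := (norm_lt_iff_sq one_pos).2 (by linarith)
  have hg0 : 0 ≤ g.re ^ 2 + g.im ^ 2 := by positivity
  have hh0 : 0 ≤ h.re ^ 2 + h.im ^ 2 := by positivity
  by_cases hg : g = 0
  · subst hg
    refine ⟨rfl, gaussianInt_eq_zero_of_sq_le ?_⟩
    have := (norm_mul_add_lt_iff 0 h w₂ one_pos).1 hA₂
    simp only [Zsqrtd.re_zero, Zsqrtd.im_zero] at this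
    norm_num at this
    rw [← GaussianInt.intCast_re, ← GaussianInt.intCast_im] at this
    have : h.re ^ 2 + h.im ^ 2 < 1 := by exact_mod_cast this
    omega
  by_cases hh : h = 0
  · subst hh
    refine ⟨gaussianInt_eq_zero_of_sq_le ?_, rfl⟩
    have := (norm_add_mul_lt_iff g 0 w₁ one_pos).1 hA₁
    simp only [Zsqrtd.re_zero, Zsqrtd.im_zero] at this
    norm_num at this
    rw [← GaussianInt.intCast_re, ← GaussianInt.intCast_im] at this
    have : g.re ^ 2 + g.im ^ 2 < 1 := by exact_mod_cast this
    omega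
  exfalso
  have hg1 : 1 ≤ g.re ^ 2 + g.im ^ 2 := by
    by_contra hc
    exact hg (gaussianInt_eq_zero_of_sq_le (by omega))
  have hh1 : 1 ≤ h.re ^ 2 + h.im ^ 2 := by
    by_contra hc
    exact hh (gaussianInt_eq_zero_of_sq_le (by omega))
  have hgap := int_gap (k := 1) (by norm_num) hw₁.le hw₂.le hA₁ hA₂ (by omega)
  have hH : h.re ^ 2 + h.im ^ 2 ≤ 7 := by
    have hdet := sq_norm_mul_det_lt hA₁ hA₂
    rw [gaussianInt_sq_norm_eq, sq_norm_eq (1 - w₁ * w₂), sq_norm_eq w₂] at hdet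
    simp only [Complex.sub_re, Complex.sub_im, Complex.mul_re, Complex.mul_im, Complex.one_re,
      Complex.one_im] at hdet
    set x₁ := w₁.re
    set y₁ := w₁.im
    set x₂ := w₂.re
    set y₂ := w₂.im
    set s₂ := x₂ ^ 2 + y₂ ^ 2 with hs₂
    have hs₂0 : 0 ≤ s₂ := by positivity
    set Q := (1 - (x₁ * x₂ - y₁ * y₂)) ^ 2 + (0 - (x₁ * y₂ + y₁ * x₂)) ^ 2 with hQ
    have hy' : y₁ ≤ 3 / 4 := by nlinarith
    have hQ1 : 1 - y₁ + s₂ * (x₁ ^ 2 - x₁ + y₁ ^ 2) ≤ Q := by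
      have : Q = 1 - 2 * (x₁ - y₁) * x₂ - 2 * y₁ * (x₂ - y₂) + (x₁ ^ 2 + y₁ ^ 2) * s₂ := by
        rw [hQ, hs₂]; ring
      nlinarith [mul_nonneg (sub_nonneg.2 hxy) (sub_nonneg.2 hD), mul_nonneg hy (sub_nonneg.2 hD')]
    -- With the determinant bound `H Q < 2 (1 + s₂)` this yields `H < 8`.
    have hQ2 : 1 + s₂ ≤ 4 * Q := by
      nlinarith [mul_nonneg hs₂0 (sq_nonneg (2 * x₁ - 1)), mul_nonneg hs₂0 (sq_nonneg (2 * y₁ - 1)),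
        mul_nonneg (sub_nonneg.2 h₂.le) (sub_nonneg.2 hy')]
    by_contra hc
    have hc' : (8 : ℝ) ≤ ((h.re ^ 2 + h.im ^ 2 : ℤ) : ℝ) := by
      exact_mod_cast (by omega : 8 ≤ h.re ^ 2 + h.im ^ 2)
    nlinarith
  refine no_short_vector_real hg1 hh1 hH ?_ hgap rfl rfl h₁ hy hxy h₂ hD hD' hR hG hB
    (by simpa only [one_pow] using (norm_add_mul_lt_iff g h w₁ one_pos).1 hA₁)
    (by simpa only [one_pow] using (norm_mul_add_lt_iff g h w₂ one_pos).1 hA₂)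
  ring

theorem no_short_vector_even {w₁ w₂ : ℂ} (g h : GaussianInt)
    (hpar : Even (g.re + g.im + (h.re + h.im)))
    (h₁ : w₁.re ^ 2 + w₁.im ^ 2 < 1) (hxy : w₁.im ≤ w₁.re)
    (hC : 1 ≤ w₁.re ^ 2 + w₁.im ^ 2 + 2 * w₁.im)
    (h₂ : w₂.re ^ 2 + w₂.im ^ 2 < 1)
    (hT : 2 * w₂.re ≤ w₂.re ^ 2 + w₂.im ^ 2 - 1)
    (hT' : 1 - (w₂.re ^ 2 + w₂.im ^ 2) ≤ 2 * w₂.im)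
    (hA₁ : ‖(g : ℂ) + h * w₁‖ < √2) (hA₂ : ‖(g : ℂ) * w₂ + h‖ < √2) : g = 0 ∧ h = 0 := by
  have hr : (0 : ℝ) < √2 := by positivity
  have hr2 : (√2 : ℝ) ^ 2 = 2 := Real.sq_sqrt (by norm_num)
  have hw₁ : ‖w₁‖ < 1 := (norm_lt_iff_sq one_pos).2 (by linarith)
  have hw₂ : ‖w₂‖ < 1 := (norm_lt_iff_sq one_pos).2 (by linarith)
  have hpar' : Even (g.re ^ 2 + g.im ^ 2 + (h.re ^ 2 + h.im ^ 2)) := by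
    simpa [Int.even_add, Int.even_pow] using hpar
  have hg0 : 0 ≤ g.re ^ 2 + g.im ^ 2 := by positivity
  have hh0 : 0 ≤ h.re ^ 2 + h.im ^ 2 := by positivity
  by_cases hg : g = 0
  · subst hg
    refine ⟨rfl, gaussianInt_eq_zero_of_sq_le ?_⟩
    have := (norm_mul_add_lt_iff 0 h w₂ hr).1 hA₂
    rw [hr2] at this
    simp only [Zsqrtd.re_zero, Zsqrtd.im_zero] at this hpar'
    norm_num at this
    rw [← GaussianInt.intCast_re, ← GaussianInt.intCast_im] at this
    have : h.re ^ 2 + h.im ^ 2 < 2 := by exact_mod_cast this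
    obtain ⟨k, hk⟩ := hpar'
    omega
  by_cases hh : h = 0
  · subst hh
    refine ⟨gaussianInt_eq_zero_of_sq_le ?_, rfl⟩
    have := (norm_add_mul_lt_iff g 0 w₁ hr).1 hA₁
    rw [hr2] at this
    simp only [Zsqrtd.re_zero, Zsqrtd.im_zero] at this hpar'
    norm_num at this
    rw [← GaussianInt.intCast_re, ← GaussianInt.intCast_im] at this
    have : g.re ^ 2 + g.im ^ 2 < 2 := by exact_mod_cast this
    obtain ⟨k, hk⟩ := hpar'
    omega
  exfalso
  have hg1 : 1 ≤ g.re ^ 2 + g.im ^ 2 := by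
    by_contra hc
    exact hg (gaussianInt_eq_zero_of_sq_le (by omega))
  have hh1 : 1 ≤ h.re ^ 2 + h.im ^ 2 := by
    by_contra hc
    exact hh (gaussianInt_eq_zero_of_sq_le (by omega))
  have hgap := int_gap (k := 2) (by rw [hr2]; norm_num) hw₁.le hw₂.le hA₁ hA₂ (by omega)
  -- In fact `|1 - w₁ w₂|² ≥ 1 + |w₁|²`. The value `8 / 7` is what turns the determinant bound, here
  -- below 8, into `H < 7` and, by symmetry, `G < 7`.
  have hQ : 8 / 7 ≤ ‖1 - w₁ * w₂‖ ^ 2 := by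
    rw [sq_norm_eq]
    simp only [Complex.sub_re, Complex.sub_im, Complex.mul_re, Complex.mul_im, Complex.one_re,
      Complex.one_im]
    set x₁ := w₁.re
    set y₁ := w₁.im
    set x₂ := w₂.re
    set y₂ := w₂.im
    set s₂ := x₂ ^ 2 + y₂ ^ 2 with hs₂
    have hs₂0 : 0 ≤ s₂ := by positivity
    have hy : 0 ≤ y₁ := by linarith
    have hx : 0 ≤ x₁ := by linarith
    have hx1 : x₁ ≤ 1 := by nlinarith
    have hy1 : y₁ ≤ 1 := by nlinarith
    have hsum : x₁ ^ 2 + y₁ ^ 2 ≤ x₁ + y₁ := by nlinarith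
    have hs : 1 / 7 ≤ x₁ ^ 2 + y₁ ^ 2 := by nlinarith
    have hQ : (1 - (x₁ * x₂ - y₁ * y₂)) ^ 2 + (0 - (x₁ * y₂ + y₁ * x₂)) ^ 2 =
        1 - 2 * x₁ * x₂ + 2 * y₁ * y₂ + (x₁ ^ 2 + y₁ ^ 2) * s₂ := by
      rw [hs₂]; ring
    rw [hQ]
    nlinarith [mul_nonneg hx (sub_nonneg.2 hT), mul_nonneg hy (sub_nonneg.2 hT'),
      mul_nonneg (sub_nonneg.2 hsum) (sub_nonneg.2 h₂.le)]
  have hH : h.re ^ 2 + h.im ^ 2 ≤ 6 := by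
    have hdet := sq_norm_mul_det_lt hA₁ hA₂
    rw [gaussianInt_sq_norm_eq, hr2] at hdet
    by_contra hc
    have hc' : (7 : ℝ) ≤ ((h.re ^ 2 + h.im ^ 2 : ℤ) : ℝ) := by
      exact_mod_cast (by omega : 7 ≤ h.re ^ 2 + h.im ^ 2)
    have : ‖w₂‖ ^ 2 < 1 := by rwa [sq_norm_eq]
    nlinarith
  have hG : g.re ^ 2 + g.im ^ 2 ≤ 6 := by
    have hdet := sq_norm_mul_det_lt (g := h) (h := g) (w₁ := w₂) (w₂ := w₁) (r := √2)
      (by rwa [add_comm]) (by rwa [add_comm])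
    rw [gaussianInt_sq_norm_eq, hr2, mul_comm w₂ w₁] at hdet
    by_contra hc
    have hc' : (7 : ℝ) ≤ ((g.re ^ 2 + g.im ^ 2 : ℤ) : ℝ) := by
      exact_mod_cast (by omega : 7 ≤ g.re ^ 2 + g.im ^ 2)
    have : ‖w₁‖ ^ 2 < 1 := by rwa [sq_norm_eq]
    nlinarith
  refine no_short_vector_real_even hg1 hh1 hG hH hpar' ?_ hgap rfl rfl h₁ hxy hC h₂ hT hT'
    (by simpa only [hr2] using (norm_add_mul_lt_iff g h w₁ hr).1 hA₁)
    (by simpa only [hr2] using (norm_mul_add_lt_iff g h w₂ hr).1 hA₂)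
  ring

/-! ### Both spans in terms of pairs of Gaussian integers -/

theorem one_add_I_ne_zero : (1 + Complex.I) ≠ 0 := by
  intro h
  simpa using congrArg Complex.re h

theorem norm_one_add_I : ‖1 + Complex.I‖ = √2 := by
  rw [Complex.norm_def, Complex.normSq_apply]
  norm_num

theorem mem_gaussInts_iff {z : ℂ} : z ∈ gaussInts ↔
    ∃ x : GaussianInt, Even (x.re + x.im) ∧ (1 + Complex.I) * z = GaussianInt.toComplex x := by
  constructor
  · rintro ⟨y, rfl⟩
    have e : (1 + Complex.I) * (y : ℂ) = GaussianInt.toComplex (⟨1, 1⟩ * y) := by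
      rw [map_mul]
      simp [GaussianInt.toComplex_def]
    exact ⟨_, (toComplex_mem_idealI_iff _).1 ⟨_, ⟨y, rfl⟩, e.symm⟩, e⟩
  · rintro ⟨x, hx, hz⟩
    obtain ⟨y, hy, hxy⟩ := (toComplex_mem_idealI_iff x).2 hx
    rw [hxy] at hz
    rwa [mul_left_cancel₀ one_add_I_ne_zero hz]

theorem mem_gaussInts_prod_union_setJ_prod_iff {g h : ℂ} :
    (g, h) ∈ gaussInts ×ˢ gaussInts ∪ setJ ×ˢ setJ ↔
      ∃ x y : GaussianInt, Even (x.re + x.im + (y.re + y.im)) ∧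
        (1 + Complex.I) * g = x ∧ (1 + Complex.I) * h = y := by
  simp only [Set.mem_union, Set.mem_prod, mem_gaussInts_iff, mem_setJ_iff]
  constructor
  · rintro (⟨⟨x, hx, hgx⟩, ⟨y, hy, hhy⟩⟩ | ⟨⟨x, hx, hgx⟩, ⟨y, hy, hhy⟩⟩)
    · exact ⟨x, y, hx.add hy, hgx, hhy⟩
    · exact ⟨x, y, hx.add_odd hy, hgx, hhy⟩
  · rintro ⟨x, y, hxy, hgx, hhy⟩
    rcases Int.even_or_odd (x.re + x.im) with hx | hx
    · exact Or.inl ⟨⟨x, hx, hgx⟩, ⟨y, (Int.even_add.1 hxy).1 hx, hhy⟩⟩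
    · exact Or.inr ⟨⟨x, hx, hgx⟩, ⟨y, (Int.even_add'.1 hxy).1 hx, hhy⟩⟩

theorem norm_lt_one_iff_mul_one_add_I (z : ℂ) : ‖z‖ < 1 ↔ ‖(1 + Complex.I) * z‖ < √2 := by
  rw [norm_mul, norm_one_add_I, mul_lt_iff_lt_one_right (by positivity)]

theorem no_gaussSpan_vector_iff {u₁ v₂ w₁ w₂ : ℂ} (hu₁ : 0 < ‖u₁‖) (hv₂ : 0 < ‖v₂‖)
    (hw₁ : ‖w₁‖ < 1) (hw₂ : ‖w₂‖ < 1) :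
    (¬ ∃ x ∈ gaussSpan (u₁, v₂ * w₂) (u₁ * w₁, v₂), x ≠ 0 ∧
      x ∈ openCylinderOf (u₁, v₂ * w₂) (u₁ * w₁, v₂)) ↔
    ∀ g h : GaussianInt, ‖(g : ℂ) + h * w₁‖ < 1 → ‖(g : ℂ) * w₂ + h‖ < 1 → g = 0 ∧ h = 0 := by
  have key := no_vector_in_openCylinderOf_iff hu₁ hv₂ hw₁ hw₂ (gaussInts ×ˢ gaussInts)
  have e : (∃ x ∈ gaussSpan (u₁, v₂ * w₂) (u₁ * w₁, v₂), x ≠ 0 ∧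
      x ∈ openCylinderOf (u₁, v₂ * w₂) (u₁ * w₁, v₂)) ↔
      ∃ x, (∃ p ∈ gaussInts ×ˢ gaussInts, x = p.1 • (u₁, v₂ * w₂) + p.2 • (u₁ * w₁, v₂)) ∧
        x ≠ 0 ∧ x ∈ openCylinderOf (u₁, v₂ * w₂) (u₁ * w₁, v₂) := by
    refine exists_congr fun x => and_congr_left fun _ => ⟨?_, ?_⟩
    · rintro ⟨g, hg, h, hh, rfl⟩
      exact ⟨(g, h), ⟨hg, hh⟩, rfl⟩
    · rintro ⟨⟨g, h⟩, ⟨hg, hh⟩, rfl⟩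
      exact ⟨g, hg, h, hh, rfl⟩
  rw [e, key]
  constructor
  · intro H g h h1 h2
    obtain ⟨hg, hh⟩ := H g h ⟨⟨g, rfl⟩, ⟨h, rfl⟩⟩ h1 h2
    exact ⟨GaussianInt.toComplex_eq_zero.1 hg, GaussianInt.toComplex_eq_zero.1 hh⟩
  · rintro H _ _ ⟨⟨g, rfl⟩, ⟨h, rfl⟩⟩ h1 h2
    obtain ⟨rfl, rfl⟩ := H g h h1 h2
    simp

theorem no_spanJ_vector_iff {u₁ v₂ w₁ w₂ : ℂ} (hu₁ : 0 < ‖u₁‖) (hv₂ : 0 < ‖v₂‖)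
    (hw₁ : ‖w₁‖ < 1) (hw₂ : ‖w₂‖ < 1) :
    (¬ ∃ x ∈ spanJ (u₁, v₂ * w₂) (u₁ * w₁, v₂), x ≠ 0 ∧
      x ∈ openCylinderOf (u₁, v₂ * w₂) (u₁ * w₁, v₂)) ↔
    ∀ g h : GaussianInt, Even (g.re + g.im + (h.re + h.im)) →
      ‖(g : ℂ) + h * w₁‖ < √2 → ‖(g : ℂ) * w₂ + h‖ < √2 → g = 0 ∧ h = 0 := by
  refine (no_vector_in_openCylinderOf_iff hu₁ hv₂ hw₁ hw₂
    (gaussInts ×ˢ gaussInts ∪ setJ ×ˢ setJ)).trans ?_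
  constructor
  · intro H x y hxy h1 h2
    have ex : (1 + Complex.I) * ((x : ℂ) / (1 + Complex.I)) = x :=
      mul_div_cancel₀ _ one_add_I_ne_zero
    have ey : (1 + Complex.I) * ((y : ℂ) / (1 + Complex.I)) = y :=
      mul_div_cancel₀ _ one_add_I_ne_zero
    obtain ⟨hg, hh⟩ := H _ _ (mem_gaussInts_prod_union_setJ_prod_iff.2 ⟨x, y, hxy, ex, ey⟩)
      (by rw [norm_lt_one_iff_mul_one_add_I, mul_add, ← mul_assoc, ex, ey]; exact h1)
      (by rw [norm_lt_one_iff_mul_one_add_I, mul_add, ← mul_assoc, ex, ey]; exact h2)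
    rw [hg, mul_zero] at ex
    rw [hh, mul_zero] at ey
    exact ⟨GaussianInt.toComplex_eq_zero.1 ex.symm, GaussianInt.toComplex_eq_zero.1 ey.symm⟩
  · intro H g h hgh h1 h2
    obtain ⟨x, y, hxy, ex, ey⟩ := mem_gaussInts_prod_union_setJ_prod_iff.1 hgh
    rw [norm_lt_one_iff_mul_one_add_I, mul_add, ← mul_assoc, ex, ey] at h1 h2
    obtain ⟨rfl, rfl⟩ := H x y hxy h1 h2
    rw [map_zero, mul_eq_zero, or_iff_right one_add_I_ne_zero] at ex ey
    exact ⟨ex, ey⟩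

/-! ### Exact criteria, and necessity from explicit vectors -/

theorem forall_no_short_vector_iff {w₁ w₂ : ℂ} (h₁ : w₁.re ^ 2 + w₁.im ^ 2 < 1)
    (hy : 0 ≤ w₁.im) (hxy : w₁.im ≤ w₁.re) (hx : 0 < w₁.re)
    (h₂ : w₂.re ^ 2 + w₂.im ^ 2 < 1) :
    (∀ g h : GaussianInt, ‖(g : ℂ) + h * w₁‖ < 1 → ‖(g : ℂ) * w₂ + h‖ < 1 → g = 0 ∧ h = 0) ↔
    2 * w₂.re ≤ w₂.re ^ 2 + w₂.im ^ 2 ∧ 2 * w₂.re ≤ w₂.re ^ 2 + w₂.im ^ 2 + 2 * w₂.im + 1 ∧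
    ¬ (w₁.re ^ 2 + w₁.im ^ 2 < 2 * w₁.im ∧ w₂.re ^ 2 + w₂.im ^ 2 + 2 * w₂.im < 0) ∧
    ¬ (w₁.re ^ 2 + w₁.im ^ 2 + 1 < 2 * w₁.re + 2 * w₁.im ∧
      w₂.re ^ 2 + w₂.im ^ 2 < w₂.re - w₂.im) ∧
    ¬ (w₁.re ^ 2 + w₁.im ^ 2 < w₁.re - w₁.im ∧
      w₂.re ^ 2 + w₂.im ^ 2 + 1 < 2 * w₂.re + 2 * w₂.im) := by
  constructor
  · intro H
    have aux (a b c d : ℤ) (hne : ¬ (a = 0 ∧ b = 0))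
        (h1 : (a + (c * w₁.re - d * w₁.im)) ^ 2 + (b + (c * w₁.im + d * w₁.re)) ^ 2 < 1)
        (h2 : (a * w₂.re - b * w₂.im + c) ^ 2 + (a * w₂.im + b * w₂.re + d) ^ 2 < 1) : False := by
      obtain ⟨hg, -⟩ := H ⟨a, b⟩ ⟨c, d⟩
        ((norm_lt_iff_sq one_pos).2 (by simpa using h1))
        ((norm_lt_iff_sq one_pos).2 (by simpa using h2))
      exact hne ⟨congrArg Zsqrtd.re hg, congrArg Zsqrtd.im hg⟩
    refine ⟨?_, ?_, ?_, ?_, ?_⟩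
    · by_contra hc
      refine aux 1 0 (-1) 0 (by simp) ?_ ?_ <;> push_cast <;> nlinarith
    · by_contra hc
      refine aux 1 0 (-1) 1 (by simp) ?_ ?_ <;> push_cast <;> nlinarith
    · rintro ⟨h3, h4⟩
      refine aux 1 0 0 1 (by simp) ?_ ?_ <;> push_cast <;> nlinarith
    · rintro ⟨h3, h4⟩
      refine aux 1 1 (-1) 0 (by simp) ?_ ?_ <;> push_cast <;> nlinarith
    · rintro ⟨h3, h4⟩
      refine aux 1 0 (-1) (-1) (by simp) ?_ ?_ <;> push_cast <;> nlinarith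
  · rintro ⟨hD, hD', hR, hG, hB⟩ g h hA₁ hA₂
    exact no_short_vector g h h₁ hy hxy h₂ hD hD' hR hG hB hA₁ hA₂

theorem forall_no_short_vector_even_iff {w₁ w₂ : ℂ} (h₁ : w₁.re ^ 2 + w₁.im ^ 2 < 1)
    (hy : 0 ≤ w₁.im) (hxy : w₁.im ≤ w₁.re) (h₂ : w₂.re ^ 2 + w₂.im ^ 2 < 1) :
    (∀ g h : GaussianInt, Even (g.re + g.im + (h.re + h.im)) →
      ‖(g : ℂ) + h * w₁‖ < √2 → ‖(g : ℂ) * w₂ + h‖ < √2 → g = 0 ∧ h = 0) ↔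
    1 ≤ w₁.re ^ 2 + w₁.im ^ 2 + 2 * w₁.im ∧ 2 * w₂.re ≤ w₂.re ^ 2 + w₂.im ^ 2 - 1 ∧
      1 - (w₂.re ^ 2 + w₂.im ^ 2) ≤ 2 * w₂.im := by
  have hr : (0 : ℝ) < √2 := by positivity
  have hr2 : (√2 : ℝ) ^ 2 = 2 := Real.sq_sqrt (by norm_num)
  constructor
  · intro H
    have aux (c d : ℤ) (hpar : Even (1 + 0 + (c + d)))
        (h1 : (1 + (c * w₁.re - d * w₁.im)) ^ 2 + (c * w₁.im + d * w₁.re) ^ 2 < 2)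
        (h2 : (w₂.re + c) ^ 2 + (w₂.im + d) ^ 2 < 2) : False := by
      obtain ⟨hg, -⟩ := H ⟨1, 0⟩ ⟨c, d⟩ hpar
        ((norm_lt_iff_sq hr).2 (by rw [hr2]; simpa using h1))
        ((norm_lt_iff_sq hr).2 (by rw [hr2]; simpa using h2))
      exact absurd (congrArg Zsqrtd.re hg) (by simp)
    -- Proved ahead of the others: the pair `(1, -i)` used next needs `|w₂ - i| < √2`, which follows
    -- from this.
    have hT' : 1 - (w₂.re ^ 2 + w₂.im ^ 2) ≤ 2 * w₂.im := by
      by_contra hc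
      refine aux 0 1 (by decide) ?_ ?_ <;> push_cast <;> nlinarith
    refine ⟨?_, ?_, hT'⟩
    · by_contra hc
      refine aux 0 (-1) (by decide) ?_ ?_ <;> push_cast <;> nlinarith
    · by_contra hc
      refine aux (-1) 0 (by decide) ?_ ?_ <;> push_cast <;> nlinarith
  · rintro ⟨hC, hT, hT'⟩ g h hpar hA₁ hA₂
    exact no_short_vector_even g h hpar h₁ hxy hC h₂ hT hT' hA₁ hA₂

/-! ### Coloured discs and the final statement -/

theorem mem_red₁_iff {z : ℂ} : z ∈ red₁ ↔ z.re ^ 2 + z.im ^ 2 < 2 * z.im := by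
  rw [red₁, mem_ball_iff_sq one_pos]
  simp only [Complex.I_re, Complex.I_im]
  constructor <;> intro h <;> linarith

theorem mem_red₂_iff {z : ℂ} : z ∈ red₂ ↔ z.re ^ 2 + z.im ^ 2 + 2 * z.im < 0 := by
  rw [red₂, mem_ball_iff_sq one_pos]
  simp only [Complex.neg_re, Complex.neg_im, Complex.I_re, Complex.I_im]
  constructor <;> intro h <;> linarith

theorem mem_blue₁_iff {z : ℂ} : z ∈ blue₁ ↔ z.re ^ 2 + z.im ^ 2 < z.re - z.im := by
  rw [blue₁, mem_ball_iff_sq (by positivity), div_pow, Real.sq_sqrt (by norm_num)]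
  have hre : ((1 - Complex.I) / 2).re = 1 / 2 := by simp
  have him : ((1 - Complex.I) / 2).im = -1 / 2 := by simp
  rw [hre, him]
  constructor <;> intro h <;> linarith

theorem mem_blue₂_iff {z : ℂ} : z ∈ blue₂ ↔ z.re ^ 2 + z.im ^ 2 + 1 < 2 * z.re + 2 * z.im := by
  rw [blue₂, mem_ball_iff_sq one_pos]
  simp only [Complex.add_re, Complex.add_im, Complex.one_re, Complex.one_im, Complex.I_re,
    Complex.I_im]
  constructor <;> intro h <;> linarith

theorem mainTheorem6 (u₁ v₂ w₁ w₂ : ℂ) (u v : ℂ × ℂ)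
    (hu : u = (u₁, v₂ * w₂)) (hv : v = (u₁ * w₁, v₂))
    (hu₁ : 0 < ‖u₁‖) (hv₂ : 0 < ‖v₂‖) (hw₁ : ‖w₁‖ < 1) (hw₂ : ‖w₂‖ < 1)
    (hC : w₁ ∈ regionC \ {0}) :
    ((¬ ∃ x ∈ gaussSpan u v, x ≠ 0 ∧ x ∈ openCylinderOf u v) ↔
      (w₂ ∈ closure regionD ∧
        ((w₂ ∈ green₂ ∧ w₁ ∉ red₁ ∪ green₁) ∨
         (w₂ ∈ red₂ \ green₂ ∧ w₁ ∉ red₁) ∨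
         (w₂ ∉ red₂ ∪ blue₂) ∨
         (w₂ ∈ blue₂ ∧ w₁ ∉ blue₁)))) ∧
    ((¬ ∃ x ∈ spanJ u v, x ≠ 0 ∧ x ∈ openCylinderOf u v) ↔
      (w₁, w₂) ∈ (regionC \ Metric.ball (-Complex.I) (Real.sqrt 2)) ×ˢ closure regionT) := by
  subst hu hv
  obtain ⟨hC, hne⟩ := hC
  obtain ⟨h₁, hy, hxy⟩ := regionC_bounds hC
  have h₂ : w₂.re ^ 2 + w₂.im ^ 2 < 1 := by simpa using (norm_lt_iff_sq one_pos).1 hw₂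
  have hx : 0 < w₁.re := by
    refine lt_of_le_of_ne (hy.trans hxy) fun h0 => hne ?_
    exact Complex.ext h0.symm (le_antisymm (hxy.trans_eq h0.symm) hy)
  rw [no_gaussSpan_vector_iff hu₁ hv₂ hw₁ hw₂, no_spanJ_vector_iff hu₁ hv₂ hw₁ hw₂,
    forall_no_short_vector_iff h₁ hy hxy hx h₂, forall_no_short_vector_even_iff h₁ hy hxy h₂,
    mem_closure_regionD_iff h₂]
  have hgreen₁ : green₁ = blue₂ := rfl
  have hgreen₂ : green₂ = blue₁ := rfl
  constructor
  · rw [hgreen₁, hgreen₂]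
    simp only [Set.mem_union, Set.mem_sdiff, mem_red₁_iff, mem_red₂_iff, mem_blue₁_iff,
      mem_blue₂_iff]
    rw [and_assoc]
    refine and_congr_right fun hD => and_congr_right fun hD' => ?_
    -- On the closure of `𝒟`, `green₂` lies inside `red₂`, and `red₂` is disjoint from `blue₂`.
    -- Hence the three obstructions regroup into the four listed cases.
    have hGR : w₂.re ^ 2 + w₂.im ^ 2 < w₂.re - w₂.im →
        w₂.re ^ 2 + w₂.im ^ 2 + 2 * w₂.im < 0 := fun h => by linarith
    have hRB : w₂.re ^ 2 + w₂.im ^ 2 + 2 * w₂.im < 0 →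
        ¬ w₂.re ^ 2 + w₂.im ^ 2 + 1 < 2 * w₂.re + 2 * w₂.im := fun h h' => by nlinarith
    tauto
  · rw [Set.mem_prod, mem_closure_regionT_iff h₂, Set.mem_sdiff, mem_ball_iff_sq (by positivity),
      Real.sq_sqrt (by norm_num)]
    simp only [Complex.neg_re, Complex.neg_im, Complex.I_re, Complex.I_im, hC, true_and, not_lt]
    refine and_congr_left fun _ => ?_
    constructor <;> intro h <;> linarith
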